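/- **Setting.** Let $d\ge 1$. For $f\in L^2(\mathbb{R}^d)$ and $g\in L^1(\mathbb{R}^d)$ put $(f\ast g)(y)=\int_{\mathbb{R}^d} f(x)g(y-x)\,dx$, $T_tf(x)=f(x-t)$, and let $\hat f$ denote the Fourier transform of $f\in L^2(\mathbb{R}^d)$, normalized by $\hat f(\xi)=\int f(x)e^{-2\pi i\langle x,\xi\rangle}dx$ for $f\in L^1\cap L^2$. Functions $\{f_\lambda\}_{\lambda\in\Lambda}\subseteq L^1(\mathbb{R}^d)\cap L^2(\mathbb{R}^d)$, indexed by a countable set $\Lambda$, are the atoms of a semi-discrete frame with frame bounds $A,B>0$ if $A\|f\|_2^2\le\sum_{\lambda\in\Lambda}\|f\ast f_\lambda\|_2^2\le B\|f\|_2^2$ for all $f\in L^2(\mathbb{R}^d)$. A frame collection $\Psi=(\Psi_n)_{n\ge 1}$ is a sequence of semi-discrete frames $\Psi_n$ with atoms $\{f_\lambda\}_{\lambda\in\Lambda_n'}$ and frame bounds $A_n,B_n$, together with a designated index $\lambda_n^\ast\in\Lambda_n'$ for each $n$; its upper frame bound is $B=\sup_n B_n$. Put $\phi_n=f_{\lambda_n^\ast}$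 and $\Lambda_n=\Lambda_n'\setminus\{\lambda_n^\ast\}$. A path of length $m\ge 0$ is a tuple $q=(\lambda_1,\dots,\lambda_m)\in\Lambda_1\times\dots\times\Lambda_m$; let $\mathcal{Q}$ be the set of all paths, including the empty one. Put $U[\lambda]f=|f\ast f_{\lambda}|$, $U[q]f=U[\lambda_m]\cdots U[\lambda_1]f$ (and $U[q]f=f$ if $q$ is empty), and $\phi[q]=\phi_{m+1}$ for $q$ of length $m$. The feature extractor is $\Phi_\Psi(f)=\{U[q]f\ast\phi[q]\}_{q\in\mathcal{Q}}$. For a family $s=\{s_q\}_{q\in\mathcal Q}$ of functions in $L^2(\mathbb{R}^d)$ put $|||s|||=(\sum_{q\in\mathcal{Q}}\|s_q\|_2^2)^{1/2}$, and let $(L^2(\mathbb{R}^d))^{\mathcal{Q}}$ be the space of those with $|||s|||<\infty$. For $R>0$ let $H_R$ be the set of $f\in L^2(\mathbb{R}^d)$ such that $\hat f$ is supported in the open ball $B_R(0)$, i.e. $\hat f=0$ almost everywhere outside $B_R(0)$. For $\omega:\mathbb{R}^d\to\mathbb{R}$ and $\tau:\mathbb{R}^d\to\mathbb{R}^d$ put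 $F_{\tau,\omega}f(x)=e^{2\pi i\omega(x)}f(x-\tau(x))$, $\|\tau\|_\infty=\sup_x|\tau(x)|$ (Euclidean norm), $\|\omega\|_\infty=\sup_x|\omega(x)|$ and $\|D\tau\|_\infty=\sup_x\max_{i,j}|\partial_j\tau_i(x)|$; these suprema may be infinite. **Theorem.** Let $d\ge1$. (a) (Translation invariance.) For every frame collection $\Psi$ with upper frame bound $B\le 1$ and every $f\in L^2(\mathbb{R}^d)$, $\Phi_\Psi(f)\in(L^2(\mathbb{R}^d))^{\mathcal{Q}}$ and $\Phi_\Psi(T_tf)=T_t\Phi_\Psi(f)$ for all $t\in\mathbb{R}^d$, where $T_t$ acts on families element by element. (b) (Deformation stability.) There is a constant $C>0$, depending only on $d$ (in particular not on $\Psi$), such that for every frame collection $\Psi$ with upper frame bound $B\le 1$, every $R>0$, every $f\in H_R$, every $\omega\in C(\mathbb{R}^d,\mathbb{R})$ and every $\tau\in C^1(\mathbb{R}^d,\mathbb{R}^d)$ with $\|D\tau\|_\infty\le\frac{1}{2d}$, one has $F_{\tau,\omega}f\in L^2(\mathbb{R}^d)$ and $$|||\Phi_\Psi(f)-\Phi_\Psi(F_{\tau,\omega}f)|||\le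 C\big(R\|\tau\|_\infty+\|\omega\|_\infty\big)\|f\|_2,$$ where the right-hand side is read in $[0,\infty]$ with $\infty\cdot 0=0$. -/

import Mathlib

open MeasureTheory
open scoped ENNReal NNReal Convolution FourierTransform

noncomputable section

namespace Scattering

universe u

/-- The convolution `(f ∗ g)(y) = ∫ f(x) g(y - x) dx` of complex functions on `ℝ^d`. -/
def conv {d : ℕ} (f g : EuclideanSpace ℝ (Fin d) → ℂ) : EuclideanSpace ℝ (Fin d) → ℂ :=
  f ⋆[ContinuousLinearMap.mul ℂ ℂ, volume] g

/-- The functions `f_λ`, `λ ∈ Λ`, in `L¹ ∩ L²` are the atoms of a semi-discrete frame with frame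
bounds `A, B > 0`: `A ‖f‖₂² ≤ ∑_λ ‖f ∗ f_λ‖₂² ≤ B ‖f‖₂²` for all `f ∈ L²`. -/
structure IsSemiDiscreteFrame {d : ℕ} {Λ : Type u} (atom : Λ → EuclideanSpace ℝ (Fin d) → ℂ)
    (A B : ℝ≥0) : Prop where
  countable : Countable Λ
  memLp_one : ∀ l, MemLp (atom l) 1 volume
  memLp_two : ∀ l, MemLp (atom l) 2 volume
  lower_pos : 0 < A
  upper_pos : 0 < B
  lower : ∀ f : EuclideanSpace ℝ (Fin d) → ℂ, MemLp f 2 volume →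
    (A : ℝ≥0∞) * eLpNorm f 2 volume ^ 2 ≤ ∑' l, eLpNorm (conv f (atom l)) 2 volume ^ 2
  upper : ∀ f : EuclideanSpace ℝ (Fin d) → ℂ, MemLp f 2 volume →
    ∑' l, eLpNorm (conv f (atom l)) 2 volume ^ 2 ≤ (B : ℝ≥0∞) * eLpNorm f 2 volume ^ 2

/-- A frame collection: a sequence of semi-discrete frames on `ℝ^d`, one per network layer, each
with one designated output-generating atom. The index `n = 0` is the first layer. -/
structure FrameCollection (d : ℕ) where
  /-- the full index set of the atoms of layer `n` -/
  Index : ℕ → Type u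
  /-- the atoms of layer `n` -/
  atom : (n : ℕ) → Index n → EuclideanSpace ℝ (Fin d) → ℂ
  /-- the lower frame bounds -/
  A : ℕ → ℝ≥0
  /-- the upper frame bounds -/
  B : ℕ → ℝ≥0
  isFrame : ∀ n, IsSemiDiscreteFrame (atom n) (A n) (B n)
  /-- the index of the output-generating atom of layer `n` -/
  out : (n : ℕ) → Index n

namespace FrameCollection

variable {d : ℕ} (Ψ : FrameCollection.{u} d)

/-- The upper frame bound `B = sup_n B_n` of a frame collection (possibly `∞`). -/
def upperBound : ℝ≥0∞ := ⨆ n, (Ψ.B n : ℝ≥0∞)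

/-- The indices of layer `n` other than that of the output-generating atom. -/
def Label (n : ℕ) : Type u := {l : Ψ.Index n // l ≠ Ψ.out n}

/-- The paths of length `m`: tuples of labels of the first `m` layers. -/
def PathOfLength (m : ℕ) : Type u := (k : Fin m) → Ψ.Label k

/-- The set of all paths of finite length. -/
def Path : Type u := Σ m : ℕ, Ψ.PathOfLength m

/-- The modulus-convolution operator `U[λ] f = |f ∗ f_λ|`. -/
def modConv (n : ℕ) (l : Ψ.Label n) (f : EuclideanSpace ℝ (Fin d) → ℂ) :
    EuclideanSpace ℝ (Fin d) → ℂ :=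
  fun x => ((‖conv f (Ψ.atom n l.1) x‖ : ℝ) : ℂ)

/-- `U[q] f = U[λ_m] ⋯ U[λ_1] f` for a path `q = (λ_1, …, λ_m)`; `U[e] f = f` for the empty
path. -/
def propagate : (m : ℕ) → Ψ.PathOfLength m → (EuclideanSpace ℝ (Fin d) → ℂ) →
    EuclideanSpace ℝ (Fin d) → ℂ
  | 0, _, f => f
  | m + 1, q, f =>
    Ψ.modConv m (q (Fin.last m)) (propagate m (fun k : Fin m => q k.castSucc) f)

/-- The feature extractor `Φ_Ψ(f) = {U[q] f ∗ φ[q]}_q`. A path of length `m` uses the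
output-generating atom of the layer that follows its last one. -/
def featureExtractor (f : EuclideanSpace ℝ (Fin d) → ℂ) (q : Ψ.Path) :
    EuclideanSpace ℝ (Fin d) → ℂ :=
  conv (Ψ.propagate q.1 q.2 f) (Ψ.atom q.1 (Ψ.out q.1))

end FrameCollection

/-- The norm `|||s||| = (∑_q ‖s_q‖₂²)^{1/2}`, with values in `[0, ∞]`. -/
def tripleNorm {d : ℕ} {Q : Type u} (s : Q → EuclideanSpace ℝ (Fin d) → ℂ) : ℝ≥0∞ :=
  (∑' q, eLpNorm (s q) 2 volume ^ 2) ^ (1 / 2 : ℝ)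

/-- The space `(L²(ℝ^d))^Q`: families of `L²` functions with finite norm `|||·|||`. -/
def ellTwo (d : ℕ) (Q : Type u) : Set (Q → EuclideanSpace ℝ (Fin d) → ℂ) :=
  {s | (∀ q, MemLp (s q) 2 volume) ∧ tripleNorm s < ∞}

/-- The space of `R`-band-limited functions: those `f ∈ L²` whose (Plancherel) Fourier transform
vanishes almost everywhere outside the open ball of radius `R` about the origin. -/
def bandLimited (d : ℕ) (R : ℝ) : Set (EuclideanSpace ℝ (Fin d) → ℂ) :=
  {f | ∃ hf : MemLp f 2 (volume : Measure (EuclideanSpace ℝ (Fin d))),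
    ∀ᵐ ξ : EuclideanSpace ℝ (Fin d), ξ ∉ Metric.ball (0 : EuclideanSpace ℝ (Fin d)) R →
      (𝓕 (hf.toLp f) : Lp ℂ 2 (volume : Measure (EuclideanSpace ℝ (Fin d)))) ξ = 0}

/-- The deformation `(F_{τ,ω} f)(x) = e^{2πiω(x)} f(x - τ(x))`. -/
def deform {d : ℕ} (τ : EuclideanSpace ℝ (Fin d) → EuclideanSpace ℝ (Fin d))
    (ω : EuclideanSpace ℝ (Fin d) → ℝ) (f : EuclideanSpace ℝ (Fin d) → ℂ) :
    EuclideanSpace ℝ (Fin d) → ℂ :=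
  fun x => Complex.exp (2 * Real.pi * Complex.I * ω x) * f (x - τ x)

/-- The supremum norm `sup_x |v(x)|`, with values in `[0, ∞]`. -/
def supNorm {X F : Type*} [NormedAddCommGroup F] (v : X → F) : ℝ≥0∞ := ⨆ x, ‖v x‖ₑ

/-- The Jacobian matrix `(∂τ_i / ∂x_j (x))_{i,j}`. -/
def jacobian {d : ℕ} (τ : EuclideanSpace ℝ (Fin d) → EuclideanSpace ℝ (Fin d))
    (x : EuclideanSpace ℝ (Fin d)) : Matrix (Fin d) (Fin d) ℝ :=
  Matrix.of fun i j => fderiv ℝ τ x (EuclideanSpace.single j 1) i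

/-- `‖Dτ‖_∞ = sup_x max_{i,j} |(Dτ)(x)_{i,j}|`, with values in `[0, ∞]`. -/
def jacobianSupNorm {d : ℕ} (τ : EuclideanSpace ℝ (Fin d) → EuclideanSpace ℝ (Fin d)) : ℝ≥0∞ :=
  ⨆ x, ⨆ i, ⨆ j, ‖jacobian τ x i j‖ₑ

end Scattering

end

/-!
Translation covariance holds because convolution commutes with translations and the modulus acts
pointwise. Everything else rests on two estimates.

The feature extractor is nonexpansive: `|||Φ(f) - Φ(g)||| ≤ ‖f - g‖₂` when all upper frame bounds
are at most one (`tripleNorm_featureExtractor_sub_le`). The frame inequality of layer `m`, applied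
to the difference of the two signals at a node of the network, bounds the squared distance of the
features generated there plus the squared distances of the signals passed on, since
`||u| - |v|| ≤ |u - v|` (`outputDist_add_layerDist_succ_le`). Summing over the layers telescopes.
For `g = 0` this is the finiteness of `|||Φ(f)|||`; for `g = F_{τ,ω} f` it reduces stability of `Φ`
to an estimate of `‖f - F_{τ,ω} f‖₂` which does not involve the network.

The deformation error is bounded by `C (R ‖τ‖_∞ + ‖ω‖_∞) ‖f‖₂` on band-limited functions
(`eLpNorm_sub_deform_le`). A band-limited `f` has a `C¹` representative `F` with
`‖DF‖₂ ≤ 2πRd ‖f‖₂`, by Plancherel (`exists_contDiff_ae_eq_of_mem_bandLimited`), and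
`|F(x) - F(x - τ(x))|² ≤ |τ(x)|² ∫₀¹ |DF(x - sτ(x))|² ds`. The bound on `Dτ` makes `τ` Lipschitz
with constant `1/2`, so each map `x ↦ x - sτ(x)` with `0 ≤ s ≤ 1` is `2`-antilipschitz, and
composition with it increases integrals at most by the factor `2^d`
(`lintegral_comp_le_of_antilipschitzWith`). Integrating in `x` and exchanging the integrals gives
the bound of the displacement; the modulation contributes at most `2π ‖ω‖_∞ 2^d ‖f‖₂`.
-/

namespace Scattering

universe u

variable {d : ℕ}

/-! ### Convolution of square-integrable functions -/

theorem convolutionExists_of_memLp_two {f g : EuclideanSpace ℝ (Fin d) → ℂ}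
    (hf : MemLp f 2 volume) (hg : MemLp g 2 volume) :
    ConvolutionExists f g (ContinuousLinearMap.mul ℂ ℂ) volume := fun y =>
  hf.integrable_mul (q := 2)
    (hg.comp_measurePreserving (Measure.measurePreserving_sub_left volume y))

theorem conv_sub_left {f₁ f₂ g : EuclideanSpace ℝ (Fin d) → ℂ} (hf₁ : MemLp f₁ 2 volume)
    (hf₂ : MemLp f₂ 2 volume) (hg : MemLp g 2 volume) :
    conv (f₁ - f₂) g = conv f₁ g - conv f₂ g := by
  ext y
  have h₁ := convolutionExists_of_memLp_two hf₁ hg y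
  have h₂ := convolutionExists_of_memLp_two hf₂ hg y
  simp only [ConvolutionExistsAt, ContinuousLinearMap.mul_apply'] at h₁ h₂
  simp only [conv, convolution_def, Pi.sub_apply, ContinuousLinearMap.mul_apply', sub_mul]
  exact integral_sub h₁ h₂

theorem conv_zero_left (g : EuclideanSpace ℝ (Fin d) → ℂ) : conv 0 g = 0 := zero_convolution

theorem aestronglyMeasurable_conv {f g : EuclideanSpace ℝ (Fin d) → ℂ}
    (hf : AEStronglyMeasurable f volume) (hg : AEStronglyMeasurable g volume) :
    AEStronglyMeasurable (conv f g) volume :=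
  (hf.convolution_integrand (ContinuousLinearMap.mul ℂ ℂ) hg).integral_prod_right'

theorem conv_translate (t : EuclideanSpace ℝ (Fin d)) (f g : EuclideanSpace ℝ (Fin d) → ℂ) :
    conv (translate t f) g = translate t (conv f g) := by
  ext y
  simp only [conv, translate_apply, convolution_def]
  rw [← integral_add_right_eq_self _ t]
  simp only [ContinuousLinearMap.mul_apply', add_sub_cancel_right, sub_add_eq_sub_sub_swap]

namespace FrameCollection

variable (Ψ : FrameCollection.{u} d)

/-! ### The propagator is nonexpansive -/

theorem coe_B_le_one (hΨ : Ψ.upperBound ≤ 1) (n : ℕ) : (Ψ.B n : ℝ≥0∞) ≤ 1 :=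
  (le_iSup (fun n => (Ψ.B n : ℝ≥0∞)) n).trans hΨ

theorem tsum_eLpNorm_conv_sq_le (hΨ : Ψ.upperBound ≤ 1) (n : ℕ)
    {f : EuclideanSpace ℝ (Fin d) → ℂ} (hf : MemLp f 2 volume) :
    ∑' l, eLpNorm (conv f (Ψ.atom n l)) 2 volume ^ 2 ≤ eLpNorm f 2 volume ^ 2 :=
  ((Ψ.isFrame n).upper f hf).trans
    (mul_le_of_le_one_left zero_le (Ψ.coe_B_le_one hΨ n))

/-- Square-integrability of `f ∗ f_λ` comes from the frame inequality itself, without appeal to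
Young's inequality. -/
theorem memLp_conv_atom (hΨ : Ψ.upperBound ≤ 1) (n : ℕ) (l : Ψ.Index n)
    {f : EuclideanSpace ℝ (Fin d) → ℂ} (hf : MemLp f 2 volume) :
    MemLp (conv f (Ψ.atom n l)) 2 volume := by
  refine ⟨aestronglyMeasurable_conv hf.1 ((Ψ.isFrame n).memLp_two l).1, ?_⟩
  have h := (ENNReal.le_tsum l).trans (Ψ.tsum_eLpNorm_conv_sq_le hΨ n hf)
  exact ((ENNReal.pow_le_pow_left_iff two_ne_zero).1 h).trans_lt hf.2

theorem memLp_modConv (hΨ : Ψ.upperBound ≤ 1) (n : ℕ) (l : Ψ.Label n)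
    {f : EuclideanSpace ℝ (Fin d) → ℂ} (hf : MemLp f 2 volume) :
    MemLp (Ψ.modConv n l f) 2 volume :=
  (Ψ.memLp_conv_atom hΨ n l.1 hf).norm.ofReal

theorem memLp_propagate (hΨ : Ψ.upperBound ≤ 1) {f : EuclideanSpace ℝ (Fin d) → ℂ}
    (hf : MemLp f 2 volume) : ∀ (m : ℕ) (q : Ψ.PathOfLength m),
    MemLp (Ψ.propagate m q f) 2 volume
  | 0, _ => hf
  | m + 1, _ => Ψ.memLp_modConv hΨ m _ (memLp_propagate hΨ hf m _)

theorem eLpNorm_modConv_sub_le (n : ℕ) (l : Ψ.Label n)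
    {f g : EuclideanSpace ℝ (Fin d) → ℂ} (hf : MemLp f 2 volume) (hg : MemLp g 2 volume) :
    eLpNorm (Ψ.modConv n l f - Ψ.modConv n l g) 2 volume ≤
      eLpNorm (conv (f - g) (Ψ.atom n l.1)) 2 volume := by
  rw [conv_sub_left hf hg ((Ψ.isFrame n).memLp_two l.1)]
  refine eLpNorm_mono fun x => ?_
  simp only [modConv, Pi.sub_apply]
  rw [← Complex.ofReal_sub, Complex.norm_real]
  exact abs_norm_sub_norm_le _ _

/-- The squared `ℓ²(L²)` distance of the propagated signals of `f` and `g` in layer `m`. -/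
noncomputable def layerDist (f g : EuclideanSpace ℝ (Fin d) → ℂ) (m : ℕ) : ℝ≥0∞ :=
  ∑' q : Ψ.PathOfLength m, eLpNorm (Ψ.propagate m q f - Ψ.propagate m q g) 2 volume ^ 2

/-- The squared `ℓ²(L²)` distance of the features of `f` and `g` that layer `m` generates. -/
noncomputable def outputDist (f g : EuclideanSpace ℝ (Fin d) → ℂ) (m : ℕ) : ℝ≥0∞ :=
  ∑' q : Ψ.PathOfLength m,
    eLpNorm (Ψ.featureExtractor f ⟨m, q⟩ - Ψ.featureExtractor g ⟨m, q⟩) 2 volume ^ 2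

/-- Energy balance of one layer: the frame inequality, applied to each difference of propagated
signals, pays both for the features of this layer and for the signals passed on to the next. -/
theorem outputDist_add_layerDist_succ_le (hΨ : Ψ.upperBound ≤ 1)
    {f g : EuclideanSpace ℝ (Fin d) → ℂ} (hf : MemLp f 2 volume) (hg : MemLp g 2 volume) (m : ℕ) :
    Ψ.outputDist f g m + Ψ.layerDist f g (m + 1) ≤ Ψ.layerDist f g m := by
  have hsnoc : Ψ.layerDist f g (m + 1) = ∑' (q : Ψ.PathOfLength m) (l : Ψ.Label m),
      eLpNorm (Ψ.modConv m l (Ψ.propagate m q f) - Ψ.modConv m l (Ψ.propagate m q g))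
        2 volume ^ 2 := by
    rw [ENNReal.tsum_comm, ← ENNReal.tsum_prod, layerDist]
    refine ((Fin.snocEquiv fun k : Fin (m + 1) => Ψ.Label k).tsum_eq _).symm.trans ?_
    refine tsum_congr fun p => ?_
    simp [propagate, Fin.snocEquiv]
  rw [hsnoc, outputDist, ← ENNReal.tsum_add]
  refine ENNReal.tsum_le_tsum fun q => ?_
  have hu := Ψ.memLp_propagate hΨ hf m q
  have hv := Ψ.memLp_propagate hΨ hg m q
  refine le_trans ?_ (Ψ.tsum_eLpNorm_conv_sq_le hΨ m (hu.sub hv))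
  rw [← ENNReal.summable.tsum_add_tsum_compl (s := {Ψ.out m}) ENNReal.summable]
  refine add_le_add (le_of_eq ?_) (ENNReal.tsum_le_tsum fun l : Ψ.Label m => ?_)
  · refine Eq.trans ?_ (tsum_singleton (Ψ.out m) fun l => eLpNorm
      (conv (Ψ.propagate m q f - Ψ.propagate m q g) (Ψ.atom m l)) 2 volume ^ 2).symm
    rw [conv_sub_left hu hv ((Ψ.isFrame m).memLp_two _)]
    rfl
  · gcongr
    exact Ψ.eLpNorm_modConv_sub_le m l hu hv

theorem layerDist_zero (f g : EuclideanSpace ℝ (Fin d) → ℂ) :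
    Ψ.layerDist f g 0 = eLpNorm (f - g) 2 volume ^ 2 := by
  have : Unique (Ψ.PathOfLength 0) := inferInstanceAs (Unique ((k : Fin 0) → Ψ.Label k))
  exact tsum_eq_single default (fun q hq => absurd (Subsingleton.elim q default) hq)

theorem sum_outputDist_add_layerDist_le (hΨ : Ψ.upperBound ≤ 1)
    {f g : EuclideanSpace ℝ (Fin d) → ℂ} (hf : MemLp f 2 volume) (hg : MemLp g 2 volume) (m : ℕ) :
    ∑ k ∈ Finset.range m, Ψ.outputDist f g k + Ψ.layerDist f g m ≤
      eLpNorm (f - g) 2 volume ^ 2 := by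
  induction m with
  | zero => simp [layerDist_zero]
  | succ m ih =>
    rw [Finset.sum_range_succ, add_assoc]
    exact (add_le_add_right (Ψ.outputDist_add_layerDist_succ_le hΨ hf hg m) _).trans ih

theorem tripleNorm_featureExtractor_sub_le (hΨ : Ψ.upperBound ≤ 1)
    {f g : EuclideanSpace ℝ (Fin d) → ℂ} (hf : MemLp f 2 volume) (hg : MemLp g 2 volume) :
    tripleNorm (Ψ.featureExtractor f - Ψ.featureExtractor g) ≤ eLpNorm (f - g) 2 volume := by
  have h : ∑' q : Ψ.Path,
      eLpNorm ((Ψ.featureExtractor f - Ψ.featureExtractor g) q) 2 volume ^ 2 ≤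
        eLpNorm (f - g) 2 volume ^ 2 := by
    refine (ENNReal.tsum_sigma' _).trans_le (ENNReal.tsum_le_of_sum_range_le fun m => ?_)
    exact le_self_add.trans (Ψ.sum_outputDist_add_layerDist_le hΨ hf hg m)
  calc tripleNorm (Ψ.featureExtractor f - Ψ.featureExtractor g)
      ≤ (eLpNorm (f - g) 2 volume ^ 2) ^ (1 / 2 : ℝ) := by
        unfold tripleNorm
        gcongr
    _ = eLpNorm (f - g) 2 volume := by
        rw [← ENNReal.rpow_natCast, ← ENNReal.rpow_mul]
        norm_num

theorem propagate_zero_right : ∀ (m : ℕ) (q : Ψ.PathOfLength m), Ψ.propagate m q 0 = 0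
  | 0, _ => rfl
  | m + 1, q => by
    ext x
    have ih := propagate_zero_right m fun k : Fin m => q k.castSucc
    simp only [propagate, modConv]
    rw [ih, conv_zero_left]
    simp

theorem featureExtractor_zero : Ψ.featureExtractor 0 = 0 := by
  ext q x
  simp [featureExtractor, propagate_zero_right, conv_zero_left]

theorem featureExtractor_mem_ellTwo (hΨ : Ψ.upperBound ≤ 1)
    {f : EuclideanSpace ℝ (Fin d) → ℂ} (hf : MemLp f 2 volume) :
    Ψ.featureExtractor f ∈ ellTwo d Ψ.Path := by
  refine ⟨fun q => Ψ.memLp_conv_atom hΨ _ _ (Ψ.memLp_propagate hΨ hf _ _), ?_⟩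
  have h := Ψ.tripleNorm_featureExtractor_sub_le hΨ hf (MemLp.zero' (p := 2))
  change tripleNorm (_ - Ψ.featureExtractor 0) ≤ eLpNorm (f - 0) 2 volume at h
  rw [featureExtractor_zero, sub_zero, sub_zero] at h
  exact h.trans_lt hf.2

/-! ### Translation covariance -/

theorem propagate_translate (t : EuclideanSpace ℝ (Fin d)) (f : EuclideanSpace ℝ (Fin d) → ℂ) :
    ∀ (m : ℕ) (q : Ψ.PathOfLength m),
      Ψ.propagate m q (translate t f) = translate t (Ψ.propagate m q f)
  | 0, _ => rfl
  | m + 1, q => by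
    ext x
    have ih := propagate_translate t f m fun k : Fin m => q k.castSucc
    simp only [propagate, modConv]
    rw [ih, conv_translate]
    rfl

theorem featureExtractor_translate (t : EuclideanSpace ℝ (Fin d))
    (f : EuclideanSpace ℝ (Fin d) → ℂ) :
    Ψ.featureExtractor (translate t f) = fun q => translate t (Ψ.featureExtractor f q) := by
  ext1 q
  simp only [featureExtractor, propagate_translate, conv_translate]

end FrameCollection

/-! ### Small perturbations of the identity -/

theorem lipschitzWith_half_of_jacobianSupNorm_le
    {τ : EuclideanSpace ℝ (Fin d) → EuclideanSpace ℝ (Fin d)} (hτ : ContDiff ℝ 1 τ)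
    (hJ : jacobianSupNorm τ ≤ ENNReal.ofReal (1 / (2 * (d : ℝ)))) :
    LipschitzWith (1 / 2) τ := by
  refine lipschitzWith_of_nnnorm_fderiv_le (hτ.differentiable one_ne_zero) fun x => ?_
  rw [← NNReal.coe_le_coe, coe_nnnorm]
  have hentry : ∀ i j, |fderiv ℝ τ x (EuclideanSpace.single j 1) i| ≤ 1 / (2 * (d : ℝ)) := by
    intro i j
    have h : ‖jacobian τ x i j‖ₑ ≤ jacobianSupNorm τ :=
      le_iSup_of_le x (le_iSup_of_le i (le_iSup_of_le j le_rfl))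
    have h' := h.trans hJ
    rwa [← ofReal_norm, ENNReal.ofReal_le_ofReal_iff (by positivity)] at h'
  refine ContinuousLinearMap.opNorm_le_bound _ (by positivity) fun v => ?_
  have hv : v = ∑ j, v j • EuclideanSpace.single j (1 : ℝ) := by
    simpa using ((EuclideanSpace.basisFun (Fin d) ℝ).sum_repr v).symm
  have hcoord : ∀ i, |fderiv ℝ τ x v i| ≤ 1 / (2 * (d : ℝ)) * ∑ j, |v j| := by
    intro i
    conv_lhs => rw [hv]
    simp only [map_sum, map_smul, WithLp.ofLp_sum, WithLp.ofLp_smul, Finset.sum_apply,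
      Pi.smul_apply, smul_eq_mul]
    refine (Finset.abs_sum_le_sum_abs _ _).trans ?_
    rw [Finset.mul_sum]
    refine Finset.sum_le_sum fun j _ => ?_
    rw [abs_mul, mul_comm]
    exact mul_le_mul_of_nonneg_right (hentry i j) (abs_nonneg _)
  have hl1 : (∑ j, |v j|) ^ 2 ≤ d * ‖v‖ ^ 2 := by
    rw [EuclideanSpace.real_norm_sq_eq]
    simpa using sq_sum_le_card_mul_sum_sq (s := Finset.univ) (f := fun j => |v j|)
  refine abs_le_of_sq_le_sq' ?_ (by positivity) |>.2
  rw [EuclideanSpace.real_norm_sq_eq]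
  calc ∑ i, (fderiv ℝ τ x v i) ^ 2
      ≤ ∑ _i : Fin d, (1 / (2 * (d : ℝ))) ^ 2 * (d * ‖v‖ ^ 2) := by
        refine Finset.sum_le_sum fun i _ => ?_
        rw [← sq_abs]
        calc |fderiv ℝ τ x v i| ^ 2 ≤ (1 / (2 * (d : ℝ)) * ∑ j, |v j|) ^ 2 := by
              gcongr
              exact hcoord i
          _ ≤ _ := by
              rw [mul_pow]
              gcongr
    _ ≤ (((1 / 2 : ℝ≥0) : ℝ) * ‖v‖) ^ 2 := by
        rcases Nat.eq_zero_or_pos d with rfl | hd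
        · simp only [Finset.univ_eq_empty, Finset.sum_empty]
          positivity
        · have : (d : ℝ) ≠ 0 := by positivity
          simp only [Finset.sum_const, Finset.card_univ, Fintype.card_fin, nsmul_eq_mul]
          refine le_of_eq ?_
          push_cast
          field_simp

theorem antilipschitzWith_two_id_sub_smul
    {τ : EuclideanSpace ℝ (Fin d) → EuclideanSpace ℝ (Fin d)} (hτ : LipschitzWith (1 / 2) τ)
    {s : ℝ} (hs : |s| ≤ 1) : AntilipschitzWith 2 fun x => x - s • τ x := by
  refine AntilipschitzWith.of_le_mul_dist fun x y => ?_
  have h := hτ.dist_le_mul x y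
  rw [dist_eq_norm] at h
  have h3 : ‖s • (τ x - τ y)‖ ≤ ‖τ x - τ y‖ := by
    rw [norm_smul]
    exact mul_le_of_le_one_left (norm_nonneg _) hs
  have h2 : dist x y ≤ dist (x - s • τ x) (y - s • τ y) + ‖s • (τ x - τ y)‖ := by
    rw [dist_eq_norm, dist_eq_norm]
    refine le_trans (le_of_eq ?_) (norm_add_le _ _)
    rw [smul_sub]
    congr 1
    abel
  push_cast at h ⊢
  linarith

/-- A map of `ℝ^d` which is `K`-antilipschitz contracts volume by at most the factor `K^d`; in
terms of preimages this is a property of the Hausdorff measure, of which the volume is a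
multiple. -/
theorem volume_preimage_le_of_antilipschitzWith
    {T : EuclideanSpace ℝ (Fin d) → EuclideanSpace ℝ (Fin d)} {K : ℝ≥0}
    (hT : AntilipschitzWith K T) (s : Set (EuclideanSpace ℝ (Fin d))) :
    volume (T ⁻¹' s) ≤ (K : ℝ≥0∞) ^ d * volume s := by
  have : Measure.IsAddHaarMeasure
      (Measure.hausdorffMeasure d : Measure (EuclideanSpace ℝ (Fin d))) := by
    simpa using isAddHaarMeasure_hausdorffMeasure (E := EuclideanSpace ℝ (Fin d))
  have hvol := Measure.isAddLeftInvariant_eq_smul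
    (volume : Measure (EuclideanSpace ℝ (Fin d))) (Measure.hausdorffMeasure d)
  have h := hT.hausdorffMeasure_preimage_le (d := d) d.cast_nonneg s
  rw [ENNReal.rpow_natCast] at h
  rw [hvol, Measure.smul_apply, Measure.smul_apply, mul_smul_comm]
  gcongr

theorem map_volume_le_of_antilipschitzWith
    {T : EuclideanSpace ℝ (Fin d) → EuclideanSpace ℝ (Fin d)} {K : ℝ≥0}
    (hT : AntilipschitzWith K T) (hTm : Measurable T) :
    Measure.map T volume ≤ (K : ℝ≥0∞) ^ d • volume := by
  refine Measure.le_iff.2 fun s hs => ?_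
  rw [Measure.map_apply hTm hs]
  exact volume_preimage_le_of_antilipschitzWith hT s

theorem quasiMeasurePreserving_of_antilipschitzWith
    {T : EuclideanSpace ℝ (Fin d) → EuclideanSpace ℝ (Fin d)} {K : ℝ≥0}
    (hT : AntilipschitzWith K T) (hTm : Measurable T) :
    Measure.QuasiMeasurePreserving T volume volume :=
  ⟨hTm, (map_volume_le_of_antilipschitzWith hT hTm).absolutelyContinuous.trans
    Measure.smul_absolutelyContinuous⟩

theorem lintegral_comp_le_of_antilipschitzWith
    {T : EuclideanSpace ℝ (Fin d) → EuclideanSpace ℝ (Fin d)} {K : ℝ≥0}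
    (hT : AntilipschitzWith K T) (hTm : Measurable T) {F : EuclideanSpace ℝ (Fin d) → ℝ≥0∞}
    (hF : AEMeasurable F volume) :
    ∫⁻ x, F (T x) ≤ (K : ℝ≥0∞) ^ d * ∫⁻ x, F x := by
  have hq := quasiMeasurePreserving_of_antilipschitzWith hT hTm
  rw [← lintegral_map' (hF.mono_ac hq.absolutelyContinuous) hTm.aemeasurable,
    ← smul_eq_mul, ← lintegral_smul_measure]
  exact lintegral_mono' (map_volume_le_of_antilipschitzWith hT hTm) le_rfl

theorem eLpNorm_two_sq {α E : Type*} [MeasurableSpace α] [NormedAddCommGroup E] (f : α → E)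
    (μ : Measure α) :
    eLpNorm f 2 μ ^ 2 = ∫⁻ x, ‖f x‖ₑ ^ 2 ∂μ := by
  simpa using! eLpNorm_nnreal_pow_eq_lintegral (f := f) (μ := μ) (p := 2) two_ne_zero

theorem eLpNorm_comp_sq_le_of_antilipschitzWith
    {T : EuclideanSpace ℝ (Fin d) → EuclideanSpace ℝ (Fin d)} {K : ℝ≥0}
    (hT : AntilipschitzWith K T) (hTm : Measurable T) {f : EuclideanSpace ℝ (Fin d) → ℂ}
    (hf : AEStronglyMeasurable f volume) :
    eLpNorm (f ∘ T) 2 volume ^ 2 ≤ (K : ℝ≥0∞) ^ d * eLpNorm f 2 volume ^ 2 := by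
  rw [eLpNorm_two_sq, eLpNorm_two_sq]
  exact lintegral_comp_le_of_antilipschitzWith hT hTm (hf.enorm.pow_const 2)

/-! ### Displacement of functions with square-integrable derivative -/

theorem sq_lintegral_le_lintegral_sq {α : Type*} [MeasurableSpace α] (μ : Measure α)
    [IsProbabilityMeasure μ] {h : α → ℝ≥0∞} (hh : AEMeasurable h μ) :
    (∫⁻ s, h s ∂μ) ^ 2 ≤ ∫⁻ s, h s ^ 2 ∂μ := by
  have := eLpNorm_le_eLpNorm_of_exponent_le (μ := μ) (f := h) (p := 1) (q := 2) one_le_two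
    hh.aestronglyMeasurable
  rw [eLpNorm_one_eq_lintegral_enorm] at this
  calc (∫⁻ s, h s ∂μ) ^ 2 ≤ eLpNorm h 2 μ ^ 2 := by gcongr; simpa using this
    _ = ∫⁻ s, h s ^ 2 ∂μ := by
      simpa using! eLpNorm_nnreal_pow_eq_lintegral (f := h) (μ := μ) (p := 2) two_ne_zero

/-- The mean value inequality in quadratic mean along the segment from `x - v` to `x`. -/
theorem enorm_sub_sq_le_lintegral_fderiv {V : Type*} [NormedAddCommGroup V] [NormedSpace ℝ V]
    {f : V → ℂ} (hf : ContDiff ℝ 1 f) (x v : V) :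
    ‖f x - f (x - v)‖ₑ ^ 2 ≤
      ‖v‖ₑ ^ 2 * ∫⁻ s : ℝ in Set.Ioc 0 1, ‖fderiv ℝ f (x - s • v)‖ₑ ^ 2 := by
  have hf' : Continuous (fderiv ℝ f) := hf.continuous_fderiv one_ne_zero
  have hderiv : ∀ s : ℝ, HasDerivAt (fun s : ℝ => f (x - s • v))
      (fderiv ℝ f (x - s • v) (-v)) s := by
    intro s
    have h1 : HasDerivAt (fun s : ℝ => x - s • v) (-v) s := by
      simpa using ((hasDerivAt_id s).smul_const v).const_sub x
    exact ((hf.differentiable one_ne_zero _).hasFDerivAt).comp_hasDerivAt s h1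
  have hcont : Continuous fun s : ℝ => fderiv ℝ f (x - s • v) := by fun_prop
  have hftc := intervalIntegral.integral_eq_sub_of_hasDerivAt (a := 0) (b := 1)
    (fun s _ => hderiv s) ((hcont.clm_apply continuous_const).intervalIntegrable _ _)
  rw [intervalIntegral.integral_of_le zero_le_one] at hftc
  simp only [one_smul, zero_smul, sub_zero] at hftc
  have hbound : ‖f x - f (x - v)‖ₑ ≤
      ∫⁻ s : ℝ in Set.Ioc 0 1, ‖v‖ₑ * ‖fderiv ℝ f (x - s • v)‖ₑ := by
    rw [← enorm_neg, neg_sub, ← hftc]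
    refine (enorm_integral_le_lintegral_enorm _).trans (lintegral_mono fun s => ?_)
    rw [mul_comm, ← enorm_neg v]
    exact ContinuousLinearMap.le_opENorm _ _
  have : IsProbabilityMeasure (volume.restrict (Set.Ioc (0 : ℝ) 1)) := ⟨by simp⟩
  rw [lintegral_const_mul _ hcont.enorm.measurable] at hbound
  calc ‖f x - f (x - v)‖ₑ ^ 2
      ≤ (‖v‖ₑ * ∫⁻ s : ℝ in Set.Ioc 0 1, ‖fderiv ℝ f (x - s • v)‖ₑ) ^ 2 := by gcongr
    _ ≤ _ := by
      rw [mul_pow]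
      gcongr
      exact sq_lintegral_le_lintegral_sq _ hcont.enorm.measurable.aemeasurable

theorem eLpNorm_sub_comp_displacement_sq_le {f : EuclideanSpace ℝ (Fin d) → ℂ}
    (hf : ContDiff ℝ 1 f) {τ : EuclideanSpace ℝ (Fin d) → EuclideanSpace ℝ (Fin d)}
    (hτ : LipschitzWith (1 / 2) τ) :
    eLpNorm (fun x => f x - f (x - τ x)) 2 volume ^ 2 ≤
      supNorm τ ^ 2 * (2 ^ d * eLpNorm (fderiv ℝ f) 2 volume ^ 2) := by
  have hf' : Continuous (fderiv ℝ f) := hf.continuous_fderiv one_ne_zero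
  have hτc : Continuous τ := hτ.continuous
  rw [eLpNorm_two_sq, eLpNorm_two_sq]
  calc ∫⁻ x, ‖f x - f (x - τ x)‖ₑ ^ 2
      ≤ ∫⁻ x, supNorm τ ^ 2 *
          ∫⁻ s : ℝ in Set.Ioc 0 1, ‖fderiv ℝ f (x - s • τ x)‖ₑ ^ 2 := by
        refine lintegral_mono fun x => (enorm_sub_sq_le_lintegral_fderiv hf x (τ x)).trans ?_
        gcongr
        exact le_iSup (fun x => ‖τ x‖ₑ) x
    _ = supNorm τ ^ 2 *
          ∫⁻ s : ℝ in Set.Ioc 0 1, ∫⁻ x, ‖fderiv ℝ f (x - s • τ x)‖ₑ ^ 2 := by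
        have hm : Measurable fun p : EuclideanSpace ℝ (Fin d) × ℝ =>
            ‖fderiv ℝ f (p.1 - p.2 • τ p.1)‖ₑ ^ 2 := by
          have : Continuous fun p : EuclideanSpace ℝ (Fin d) × ℝ =>
            fderiv ℝ f (p.1 - p.2 • τ p.1) := by fun_prop
          exact this.enorm.measurable.pow_const 2
        rw [lintegral_const_mul _ hm.lintegral_prod_right',
          lintegral_lintegral_swap hm.aemeasurable]
    _ ≤ supNorm τ ^ 2 * ∫⁻ _s : ℝ in Set.Ioc 0 1, 2 ^ d * ∫⁻ x, ‖fderiv ℝ f x‖ₑ ^ 2 := by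
        refine mul_le_mul' le_rfl (setLIntegral_mono measurable_const fun s hs => ?_)
        exact lintegral_comp_le_of_antilipschitzWith
          (antilipschitzWith_two_id_sub_smul hτ (abs_le.2 ⟨by linarith [hs.1], hs.2⟩))
          (by fun_prop) (hf'.enorm.measurable.pow_const 2).aemeasurable
    _ = _ := by simp

/-! ### The Fourier transform on `L¹ ∩ L²` -/

/-- On `L¹ ∩ L²` the inverse Plancherel transform is given by the Fourier integral: both represent
the same tempered distribution. -/
theorem fourierInv_toLp_ae_eq {V : Type*} [NormedAddCommGroup V] [InnerProductSpace ℝ V]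
    [FiniteDimensional ℝ V] [MeasurableSpace V] [BorelSpace V] {g : V → ℂ}
    (h₁ : Integrable g volume) (h₂ : MemLp g 2 volume) :
    (𝓕⁻ (h₂.toLp g) : Lp ℂ 2 (volume : Measure V)) =ᵐ[volume] 𝓕⁻ g := by
  have hcont : Continuous (𝓕⁻ g) := by
    have : Continuous (𝓕 g) :=
      VectorFourier.fourierIntegral_continuous Real.continuous_fourierChar
        (by exact continuous_inner) h₁
    have h : 𝓕⁻ g = fun x => 𝓕 g (-x) := funext fun x => Real.fourierInv_eq_fourier_neg g x
    rw [h]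
    exact this.comp continuous_neg
  refine ae_eq_of_integral_contDiff_smul_eq
    ((Lp.memLp _).locallyIntegrable one_le_two) hcont.locallyIntegrable fun φ hφ hφc => ?_
  have hc : HasCompactSupport (Complex.ofRealCLM ∘ φ) := hφc.comp_left rfl
  have hs : ContDiff ℝ (↑(⊤ : ℕ∞)) (Complex.ofRealCLM ∘ φ) :=
    Complex.ofRealCLM.contDiff.comp hφ
  set θ : SchwartzMap V ℂ := hc.toSchwartzMap hs
  have hθφ : ∀ x, θ x = (φ x : ℂ) := fun x => rfl
  have key := congrArg (fun T => T θ) (Lp.fourierInv_toTemperedDistribution_eq (h₂.toLp g))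
  simp only [TemperedDistribution.fourierInv_apply, Lp.toTemperedDistribution_apply] at key
  have hφs : ∀ (x : V) (z : ℂ), φ x • z = θ x • z := fun x z => by
    rw [hθφ, Complex.real_smul, smul_eq_mul]
  simp only [hφs]
  rw [← key]
  have h3 : ∫ x, (𝓕⁻ θ) x • (h₂.toLp g : V → ℂ) x = ∫ x, (𝓕⁻ θ) x • g x :=
    integral_congr_ae (h₂.coeFn_toLp.mono fun x hx => by simp only [hx])
  rw [h3]
  have h4 := VectorFourier.integral_fourierIntegral_smul_eq_flip (L := -innerₗ V)
    (μ := (volume : Measure V)) (ν := (volume : Measure V)) Real.continuous_fourierChar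
    (by exact (continuous_inner (𝕜 := ℝ) (E := V)).neg) θ.integrable h₁
  have hflip : (-innerₗ V).flip = -innerₗ V := by
    ext v w
    simp [real_inner_comm]
  rw [hflip] at h4
  rw [SchwartzMap.fourierInv_coe]
  exact h4

/-- Plancherel's identity for the Fourier integral of a function in `L¹ ∩ L²`. -/
theorem eLpNorm_fourier_eq {V : Type*} [NormedAddCommGroup V] [InnerProductSpace ℝ V]
    [FiniteDimensional ℝ V] [MeasurableSpace V] [BorelSpace V] {g : V → ℂ}
    (h₁ : Integrable g volume) (h₂ : MemLp g 2 volume) :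
    eLpNorm (𝓕 g) 2 volume = eLpNorm g 2 volume := by
  have hneg := Measure.measurePreserving_neg (volume : Measure V)
  have h₂' : MemLp (fun x => g (-x)) 2 volume := h₂.comp_measurePreserving hneg
  have h : 𝓕 g = 𝓕⁻ fun x => g (-x) := by
    ext w
    simp [Real.fourierInv_eq_fourier_comp_neg]
  rw [h, ← eLpNorm_congr_ae (fourierInv_toLp_ae_eq h₁.comp_neg h₂'),
    ← ENNReal.toReal_eq_toReal_iff' (Lp.eLpNorm_ne_top _) h₂.2.ne, ← Lp.norm_def]
  have h5 : ‖(𝓕⁻ (h₂'.toLp _) : Lp ℂ 2 (volume : Measure V))‖ = ‖h₂'.toLp _‖ :=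
    (Lp.fourierTransformₗᵢ V ℂ).symm.norm_map _
  rw [h5, Lp.norm_toLp]
  congr 1
  exact eLpNorm_comp_measurePreserving h₂.1 hneg

/-- A band-limited function agrees almost everywhere with a `C¹` function whose derivative obeys
the `L²` Bernstein inequality; the constant is not optimal. -/
theorem exists_contDiff_ae_eq_of_mem_bandLimited {R : ℝ}
    {f : EuclideanSpace ℝ (Fin d) → ℂ} (hf : f ∈ bandLimited d R) :
    ∃ F : EuclideanSpace ℝ (Fin d) → ℂ, ContDiff ℝ 1 F ∧ f =ᵐ[volume] F ∧
      eLpNorm (fderiv ℝ F) 2 volume ≤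
        ENNReal.ofReal (d * (2 * Real.pi * R)) * eLpNorm f 2 volume := by
  obtain ⟨hf2, hsupp⟩ := hf
  set g : EuclideanSpace ℝ (Fin d) → ℂ :=
    ⇑(𝓕 (hf2.toLp f) : Lp ℂ 2 (volume : Measure (EuclideanSpace ℝ (Fin d)))) with hg
  have hg2 : MemLp g 2 volume := Lp.memLp _
  have hneg := Measure.measurePreserving_neg (volume : Measure (EuclideanSpace ℝ (Fin d)))
  -- a representative of the Fourier transform which vanishes outside the ball everywhere
  set G : EuclideanSpace ℝ (Fin d) → ℂ := (Metric.ball 0 R).indicator g with hG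
  have hGg : G =ᵐ[volume] g := by
    filter_upwards [hsupp] with ξ hξ
    by_cases h : ξ ∈ Metric.ball 0 R
    · rw [hG, Set.indicator_of_mem h]
    · rw [hG, Set.indicator_of_notMem h, hξ h]
  have hG2 : MemLp G 2 volume := hg2.indicator Metric.isOpen_ball.measurableSet
  have hGnorm : eLpNorm G 2 volume = eLpNorm f 2 volume := by
    rw [eLpNorm_congr_ae hGg,
      ← ENNReal.toReal_eq_toReal_iff' (Lp.eLpNorm_ne_top _) hf2.2.ne, ← Lp.norm_def,
      Lp.norm_fourier_eq, Lp.norm_toLp]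
  have hG1 : Integrable G volume := by
    rw [hG, integrable_indicator_iff Metric.isOpen_ball.measurableSet]
    have : IsFiniteMeasure ((volume : Measure (EuclideanSpace ℝ (Fin d))).restrict
        (Metric.ball 0 R)) := ⟨by simpa using measure_ball_lt_top⟩
    exact (hg2.restrict _).integrable one_le_two
  have hfF : f =ᵐ[volume] 𝓕⁻ G := by
    have h : hG2.toLp G = 𝓕 (hf2.toLp f) := Lp.ext (hG2.coeFn_toLp.trans hGg)
    have h' := fourierInv_toLp_ae_eq hG1 hG2
    rw [h, FourierTransform.fourierInv_fourier_eq] at h'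
    exact hf2.coeFn_toLp.symm.trans h'
  set H : EuclideanSpace ℝ (Fin d) → ℂ := fun ξ => G (-ξ) with hH
  have hF : 𝓕⁻ G = 𝓕 H := Real.fourierInv_eq_fourier_comp_neg G
  have hH1 : Integrable H volume := hG1.comp_neg
  have hH2 : MemLp H 2 volume := hG2.comp_measurePreserving hneg
  have hHnorm : eLpNorm H 2 volume = eLpNorm f 2 volume :=
    (eLpNorm_comp_measurePreserving hG2.1 hneg).trans hGnorm
  have hHsupp : ∀ ξ, ‖ξ‖ * ‖H ξ‖ ≤ R * ‖H ξ‖ := by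
    intro ξ
    by_cases h : -ξ ∈ Metric.ball 0 R
    · gcongr
      simpa using (mem_ball_zero_iff.1 h).le
    · simp [hH, hG, Set.indicator_of_notMem h]
  have hξH : Integrable (fun ξ => ‖ξ‖ * ‖H ξ‖) volume := by
    refine (hH1.norm.const_mul R).mono' (by fun_prop) (.of_forall fun ξ => ?_)
    simpa using hHsupp ξ
  have hsmooth : ContDiff ℝ 1 (𝓕 H) := by
    refine Real.contDiff_fourier (N := 1) fun n hn => ?_
    have hn' : n ≤ 1 := by exact_mod_cast hn
    interval_cases n
    · simpa using hH1.norm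
    · simpa using hξH
  refine ⟨𝓕⁻ G, hF ▸ hsmooth, hfF, ?_⟩
  rw [hF]
  have hDint : Integrable (VectorFourier.fourierSMulRight (innerSL ℝ) H) volume := by
    refine (hξH.const_mul (2 * Real.pi * ‖innerSL ℝ (E := EuclideanSpace ℝ (Fin d))‖)).mono'
      hH1.1.fourierSMulRight (.of_forall fun ξ => ?_)
    refine (VectorFourier.norm_fourierSMulRight_le _ _ _).trans (le_of_eq ?_)
    ring
  -- each partial derivative is the Fourier transform of `H` times a coordinate, which is at most
  -- `R` in absolute value on the support of `H`
  have hpartial : ∀ j : Fin d,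
      eLpNorm (fun x => fderiv ℝ (𝓕 H) x (EuclideanSpace.single j 1)) 2 volume ≤
        ENNReal.ofReal (2 * Real.pi * R) * eLpNorm f 2 volume := by
    intro j
    set h : EuclideanSpace ℝ (Fin d) → ℂ := fun ξ =>
      VectorFourier.fourierSMulRight (innerSL ℝ) H ξ (EuclideanSpace.single j 1) with hh
    have hle : ∀ ξ, ‖h ξ‖ ≤ 2 * Real.pi * R * ‖H ξ‖ := by
      intro ξ
      have hξ : ‖ξ j‖ * ‖H ξ‖ ≤ R * ‖H ξ‖ :=
        le_trans (by gcongr; exact PiLp.norm_apply_le ξ j) (hHsupp ξ)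
      have : ‖h ξ‖ = 2 * Real.pi * (‖ξ j‖ * ‖H ξ‖) := by
        have hin : innerSL ℝ ξ (EuclideanSpace.single j (1 : ℝ)) = ξ j := by
          simp [innerSL_apply_apply, EuclideanSpace.inner_single_right]
        simp only [hh]
        rw [VectorFourier.fourierSMulRight_apply, hin, norm_smul, norm_smul]
        simp [abs_of_pos Real.pi_pos]
      rw [this, mul_assoc (2 * Real.pi)]
      exact mul_le_mul_of_nonneg_left hξ (by positivity)
    have h1 : Integrable h volume := hDint.apply_continuousLinearMap _
    have h2 : MemLp h 2 volume := hH2.of_le_mul h1.1 (.of_forall hle)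
    have heq : (fun x => fderiv ℝ (𝓕 H) x (EuclideanSpace.single j 1)) = 𝓕 h := by
      ext x
      rw [(Real.hasFDerivAt_fourier hH1 hξH x).fderiv,
        Real.fourier_continuousLinearMap_apply hDint]
    rw [heq, eLpNorm_fourier_eq h1 h2, ← hHnorm]
    exact eLpNorm_le_mul_eLpNorm_of_ae_le_mul (.of_forall hle) 2
  have hfderiv : Continuous (fderiv ℝ (𝓕 H)) := hsmooth.continuous_fderiv one_ne_zero
  calc eLpNorm (fderiv ℝ (𝓕 H)) 2 volume
      ≤ eLpNorm (∑ j : Fin d, fun x => ‖fderiv ℝ (𝓕 H) x (EuclideanSpace.single j 1)‖)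
          2 volume := by
        refine eLpNorm_mono_real fun x => ?_
        simp only [Finset.sum_apply]
        refine ContinuousLinearMap.opNorm_le_bound _ (by positivity) fun v => ?_
        have hv : v = ∑ j, v j • EuclideanSpace.single j (1 : ℝ) := by
          simpa using ((EuclideanSpace.basisFun (Fin d) ℝ).sum_repr v).symm
        conv_lhs => rw [hv]
        rw [map_sum, Finset.sum_mul]
        refine norm_sum_le_of_le _ fun j _ => ?_
        rw [map_smul, norm_smul, mul_comm]
        gcongr
        exact PiLp.norm_apply_le v j
    _ ≤ ∑ j : Fin d, eLpNorm (fun x => ‖fderiv ℝ (𝓕 H) x (EuclideanSpace.single j 1)‖)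
          2 volume :=
        eLpNorm_sum_le (fun j _ => (hfderiv.clm_apply continuous_const).norm.aestronglyMeasurable)
          one_le_two
    _ ≤ ∑ _j : Fin d, ENNReal.ofReal (2 * Real.pi * R) * eLpNorm f 2 volume :=
        Finset.sum_le_sum fun j _ => (eLpNorm_norm _).trans_le (hpartial j)
    _ = _ := by
        rw [Finset.sum_const, Finset.card_univ, Fintype.card_fin, nsmul_eq_mul, ← mul_assoc,
          ENNReal.ofReal_mul d.cast_nonneg, ENNReal.ofReal_natCast]

/-! ### The deformation error -/

theorem enorm_one_sub_cexp_le (θ : ℝ) :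
    ‖1 - Complex.exp (2 * Real.pi * Complex.I * θ)‖ₑ ≤ ENNReal.ofReal (2 * Real.pi) * ‖θ‖ₑ := by
  have h := Real.norm_exp_I_mul_ofReal_sub_one_le (x := 2 * Real.pi * θ)
  have harg : (2 * Real.pi * Complex.I * θ : ℂ) = Complex.I * ((2 * Real.pi * θ : ℝ) : ℂ) := by
    push_cast
    ring
  rw [harg, ← ofReal_norm, ← ofReal_norm, ← ENNReal.ofReal_mul (by positivity), norm_sub_rev]
  refine ENNReal.ofReal_le_ofReal (h.trans (le_of_eq ?_))
  rw [norm_mul, Real.norm_of_nonneg (by positivity : (0 : ℝ) ≤ 2 * Real.pi)]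

theorem norm_deform (τ : EuclideanSpace ℝ (Fin d) → EuclideanSpace ℝ (Fin d))
    (ω : EuclideanSpace ℝ (Fin d) → ℝ) (f : EuclideanSpace ℝ (Fin d) → ℂ)
    (x : EuclideanSpace ℝ (Fin d)) : ‖deform τ ω f x‖ = ‖f (x - τ x)‖ := by
  have harg : (2 * Real.pi * Complex.I * ω x : ℂ) = Complex.I * ((2 * Real.pi * ω x : ℝ) : ℂ) := by
    push_cast
    ring
  rw [deform, norm_mul, harg, Complex.norm_exp_I_mul_ofReal, one_mul]

theorem antilipschitzWith_two_id_sub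
    {τ : EuclideanSpace ℝ (Fin d) → EuclideanSpace ℝ (Fin d)} (hτ : LipschitzWith (1 / 2) τ) :
    AntilipschitzWith 2 fun x => x - τ x := by
  simpa using antilipschitzWith_two_id_sub_smul hτ (s := 1) (by simp)

theorem eLpNorm_comp_id_sub_le
    {τ : EuclideanSpace ℝ (Fin d) → EuclideanSpace ℝ (Fin d)} (hτ : LipschitzWith (1 / 2) τ)
    {f : EuclideanSpace ℝ (Fin d) → ℂ} (hf : AEStronglyMeasurable f volume) :
    eLpNorm (fun x => f (x - τ x)) 2 volume ≤ 2 ^ d * eLpNorm f 2 volume := by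
  have hτc := hτ.continuous
  -- the sharp factor `2 ^ (d / 2)` is weakened to `2 ^ d` to avoid square roots
  rw [← ENNReal.pow_le_pow_left_iff two_ne_zero, mul_pow]
  refine (eLpNorm_comp_sq_le_of_antilipschitzWith (antilipschitzWith_two_id_sub hτ)
    (by fun_prop) hf).trans ?_
  refine mul_le_mul' ?_ le_rfl
  exact le_self_pow (one_le_pow₀ (M₀ := ℝ≥0∞) (a := 2) one_le_two) two_ne_zero

theorem memLp_deform {τ : EuclideanSpace ℝ (Fin d) → EuclideanSpace ℝ (Fin d)}
    (hτ : LipschitzWith (1 / 2) τ) {ω : EuclideanSpace ℝ (Fin d) → ℝ} (hω : Continuous ω)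
    {f : EuclideanSpace ℝ (Fin d) → ℂ} (hf : MemLp f 2 volume) :
    MemLp (deform τ ω f) 2 volume := by
  have hτc := hτ.continuous
  have hq := quasiMeasurePreserving_of_antilipschitzWith (antilipschitzWith_two_id_sub hτ)
    (by fun_prop)
  have hm : AEStronglyMeasurable (fun x => f (x - τ x)) volume :=
    hf.1.comp_quasiMeasurePreserving hq
  refine ⟨AEStronglyMeasurable.mul (Continuous.aestronglyMeasurable (by fun_prop)) hm, ?_⟩
  rw [eLpNorm_congr_norm_ae (.of_forall (norm_deform τ ω f))]
  exact (eLpNorm_comp_id_sub_le hτ hf.1).trans_lt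
    (ENNReal.mul_lt_top (by simp) hf.2)

theorem eLpNorm_sub_comp_id_sub_le {R : ℝ} {f : EuclideanSpace ℝ (Fin d) → ℂ}
    (hf : f ∈ bandLimited d R) {τ : EuclideanSpace ℝ (Fin d) → EuclideanSpace ℝ (Fin d)}
    (hτ : LipschitzWith (1 / 2) τ) :
    eLpNorm (fun x => f x - f (x - τ x)) 2 volume ≤
      supNorm τ * (2 ^ d * (ENNReal.ofReal (d * (2 * Real.pi * R)) * eLpNorm f 2 volume)) := by
  obtain ⟨F, hF, hfF, hDF⟩ := exists_contDiff_ae_eq_of_mem_bandLimited hf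
  have hτc := hτ.continuous
  have hq := quasiMeasurePreserving_of_antilipschitzWith (antilipschitzWith_two_id_sub hτ)
    (by fun_prop)
  have hae : (fun x => f x - f (x - τ x)) =ᵐ[volume] fun x => F x - F (x - τ x) := by
    filter_upwards [hfF, hq.ae_eq_comp hfF] with x h₁ h₂
    rw [h₁]
    exact congrArg _ h₂
  rw [eLpNorm_congr_ae hae, ← ENNReal.pow_le_pow_left_iff two_ne_zero]
  refine (eLpNorm_sub_comp_displacement_sq_le hF hτ).trans ?_
  rw [mul_pow, mul_pow (2 ^ d)]
  refine mul_le_mul' le_rfl (mul_le_mul' ?_ (by gcongr))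
  exact le_self_pow (one_le_pow₀ one_le_two) two_ne_zero

/-- The deformation error splits into a displacement, controlled by the Bernstein inequality, and a
modulation. -/
theorem eLpNorm_sub_deform_le (hd : 0 < d) {R : ℝ}
    {f : EuclideanSpace ℝ (Fin d) → ℂ} (hf : f ∈ bandLimited d R)
    {ω : EuclideanSpace ℝ (Fin d) → ℝ} (hω : Continuous ω)
    {τ : EuclideanSpace ℝ (Fin d) → EuclideanSpace ℝ (Fin d)} (hτ : LipschitzWith (1 / 2) τ) :
    eLpNorm (f - deform τ ω f) 2 volume ≤
      ENNReal.ofReal (2 ^ d * (d * (2 * Real.pi))) *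
        (ENNReal.ofReal R * supNorm τ + supNorm ω) * eLpNorm f 2 volume := by
  have hf2 : MemLp f 2 volume := hf.1
  have hτc := hτ.continuous
  have hq := quasiMeasurePreserving_of_antilipschitzWith (antilipschitzWith_two_id_sub hτ)
    (by fun_prop)
  have hm : AEStronglyMeasurable (fun x => f (x - τ x)) volume :=
    hf2.1.comp_quasiMeasurePreserving hq
  have hsplit : f - deform τ ω f = (fun x => f x - f (x - τ x)) +
      fun x => (1 - Complex.exp (2 * Real.pi * Complex.I * ω x)) * f (x - τ x) := by
    ext x
    simp only [deform, Pi.sub_apply, Pi.add_apply]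
    ring
  have hmod : eLpNorm (fun x => (1 - Complex.exp (2 * Real.pi * Complex.I * ω x)) * f (x - τ x))
      2 volume ≤ ENNReal.ofReal (2 * Real.pi) * supNorm ω * (2 ^ d * eLpNorm f 2 volume) := by
    refine le_trans ?_ (mul_le_mul' le_rfl (eLpNorm_comp_id_sub_le hτ hf2.1))
    rw [← ENNReal.pow_le_pow_left_iff two_ne_zero, mul_pow, eLpNorm_two_sq, eLpNorm_two_sq,
      ← lintegral_const_mul'' _ (hm.enorm.pow_const 2)]
    refine lintegral_mono fun x => ?_
    rw [enorm_mul, mul_pow]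
    gcongr
    refine (enorm_one_sub_cexp_le (ω x)).trans ?_
    gcongr
    exact le_iSup (fun x => ‖ω x‖ₑ) x
  have hd1 : (1 : ℝ≥0∞) ≤ d := by exact_mod_cast hd
  have hmeas : AEStronglyMeasurable (fun x => f x - f (x - τ x)) volume := hf2.1.sub hm
  rw [hsplit]
  refine (eLpNorm_add_le hmeas
    (AEStronglyMeasurable.mul (Continuous.aestronglyMeasurable (by fun_prop)) hm)
    one_le_two).trans ((add_le_add (eLpNorm_sub_comp_id_sub_le hf hτ) hmod).trans ?_)
  rw [ENNReal.ofReal_mul (by positivity), ENNReal.ofReal_mul (by positivity),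
    ENNReal.ofReal_mul (by positivity : (0 : ℝ) ≤ 2 ^ d),
    ENNReal.ofReal_mul (by positivity : (0 : ℝ) ≤ d),
    ENNReal.ofReal_natCast, ENNReal.ofReal_pow zero_le_two, ENNReal.ofReal_ofNat]
  calc _ ≤ supNorm τ * (2 ^ d * (d * (ENNReal.ofReal (2 * Real.pi) * ENNReal.ofReal R) *
            eLpNorm f 2 volume)) +
          d * (ENNReal.ofReal (2 * Real.pi) * supNorm ω * (2 ^ d * eLpNorm f 2 volume)) :=
        add_le_add le_rfl (le_mul_of_one_le_left zero_le hd1)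
    _ = _ := by ring

end Scattering

theorem theorem1 (d : ℕ) (hd : 0 < d) :
    (∀ Ψ : Scattering.FrameCollection d, Ψ.upperBound ≤ 1 →
      ∀ f : EuclideanSpace ℝ (Fin d) → ℂ, MemLp f 2 volume →
        Ψ.featureExtractor f ∈ Scattering.ellTwo d Ψ.Path ∧
        ∀ t : EuclideanSpace ℝ (Fin d),
          Ψ.featureExtractor (translate t f) =
            fun q => translate t (Ψ.featureExtractor f q)) ∧
    ∃ C : ℝ, 0 < C ∧
      ∀ Ψ : Scattering.FrameCollection d, Ψ.upperBound ≤ 1 →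
      ∀ R : ℝ, 0 < R →
      ∀ f ∈ Scattering.bandLimited d R,
      ∀ ω : EuclideanSpace ℝ (Fin d) → ℝ, Continuous ω →
      ∀ τ : EuclideanSpace ℝ (Fin d) → EuclideanSpace ℝ (Fin d), ContDiff ℝ 1 τ →
        Scattering.jacobianSupNorm τ ≤ ENNReal.ofReal (1 / (2 * (d : ℝ))) →
        MemLp (Scattering.deform τ ω f) 2 volume ∧
        Scattering.tripleNorm
            (Ψ.featureExtractor f - Ψ.featureExtractor (Scattering.deform τ ω f)) ≤
          ENNReal.ofReal C *
            (ENNReal.ofReal R * Scattering.supNorm τ + Scattering.supNorm ω) *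
            eLpNorm f 2 volume := by
  refine ⟨fun Ψ hΨ f hf => ⟨Ψ.featureExtractor_mem_ellTwo hΨ hf,
    fun t => Ψ.featureExtractor_translate t f⟩, 2 ^ d * (d * (2 * Real.pi)), by positivity,
    fun Ψ hΨ R _ f hf ω hω τ hτ hJ => ?_⟩
  have hlip := Scattering.lipschitzWith_half_of_jacobianSupNorm_le hτ hJ
  have hdeform := Scattering.memLp_deform hlip hω hf.1
  exact ⟨hdeform, (Ψ.tripleNorm_featureExtractor_sub_le hΨ hf.1 hdeform).trans
    (Scattering.eLpNorm_sub_deform_le hd hf hω hlip)⟩
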